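/- By a semifield we mean a set $S$ with two associative, commutative operations $+$ and $\times$ such that $\times$ distributes over $+$, there is an element $0$ which is an identity for $+$ and a zero for $\times$, and $S\setminus\{0\}$ is a group under $\times$. For $n \in \mathbb{N}$, let $M_n(S)$ be the set of $n\times n$ matrices over $S$, viewed both as an $S$-module and as a monoid under matrix multiplication, and let $GL_n(S)$ be its group of multiplicatively invertible elements. For $A,B\in M_n(S)$ write $A\leq_{\mathcal R}B$ if $A=BX$ for some $X\in M_n(S)$, and $A\leq_{\mathcal L}B$ if $A=XB$ for some $X\in M_n(S)$. Write $A\leq_{\mathcal H}B$ if both $A\leq_{\mathcal R}B$ and $A\leq_{\mathcal L}B$, and $A\,\mathcal H\,B$ if both $A\leq_{\mathcal H}B$ and $B\leq_{\mathcal H}A$. A map $T$ preserves a binary relation $\equiv$ on $M_n(S)$ if $A\equiv B$ implies $T(A)\equiv T(B)$ for all $A,B\in M_n(S)$. **Theorem.** Let $S$ be a semifield and let $T\colon M_n(S)\to M_n(S)$ be a bijective $S$-linear map. The following are equivalent: 1. $T$ preserves $\mathcal H$; 2. $T$ preserves $\leq_{\mathcal H}$; 3. there exist $P,Q\in GL_n(S)$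 such that either $T(A)=PAQ$ for all $A\in M_n(S)$, or $T(A)=PA^{T}Q$ for all $A\in M_n(S)$. -/

import Mathlib

namespace Green

/-- `a ≤_R b` in a monoid: `a = b s` for some `s`. -/
def LeR {M : Type*} [Monoid M] (a b : M) : Prop := ∃ s : M, a = b * s

/-- `a ≤_L b` in a monoid: `a = s b` for some `s`. -/
def LeL {M : Type*} [Monoid M] (a b : M) : Prop := ∃ s : M, a = s * b

/-- Green's relation `R`. -/
def RelR {M : Type*} [Monoid M] (a b : M) : Prop := LeR a b ∧ LeR b a

/-- Green's relation `L`. -/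
def RelL {M : Type*} [Monoid M] (a b : M) : Prop := LeL a b ∧ LeL b a

/-- `a ≤_H b` in a monoid: `a ≤_R b` and `a ≤_L b`. -/
def LeH {M : Type*} [Monoid M] (a b : M) : Prop := LeR a b ∧ LeL a b

/-- Green's relation `H`: `a R b` and `a L b`. -/
def RelH {M : Type*} [Monoid M] (a b : M) : Prop := RelR a b ∧ RelL a b

end Green

/-- `f` (weakly) preserves the binary relation `r`. -/
def PreservesRel {X : Type*} (r : X → X → Prop) (f : X → X) : Prop :=
  ∀ a b : X, r a b → r (f a) (f b)

open Matrix

/-! ### Green's relations under units and transposition -/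

namespace Green

section CommSemiring

variable {ι S : Type*} [Fintype ι] [DecidableEq ι] [CommSemiring S]

/-! Only preserving `RelH` forces a form, and everything is read off the inverse map on matrix
units. A semifield is either a field or antinegative (`a + b = 0` forces `a = 0`). In both cases the
inverse image of a matrix unit is a rank-one matrix `x yᵀ`: over a field because `H`-classes of
rank-one matrices are too small, in the antinegative case because sums cannot cancel. Units in a
common row or column pull back to rank-ones sharing a left or a right factor, and injectivity with a
count then lets `row_column_dichotomy` separate the indices, up to a transpose: `E_ij ↦ c_ij x_i
y_jᵀ`. A last use of `H` shows that `c` has vanishing 2×2 minors, so it is absorbed into diagonal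
units. -/

theorem LeH.relH {M : Type*} [Monoid M] {a b : M} (h₁ : LeH a b) (h₂ : LeH b a) : RelH a b :=
  ⟨⟨h₁.1, h₂.1⟩, h₁.2, h₂.2⟩

theorem RelH.leH {M : Type*} [Monoid M] {a b : M} (h : RelH a b) : LeH a b := ⟨h.1.1, h.2.1⟩

theorem RelH.symm {M : Type*} [Monoid M] {a b : M} (h : RelH a b) : RelH b a :=
  ⟨h.1.symm, h.2.symm⟩

theorem LeH.units_mul_mul {M : Type*} [Monoid M] {a b : M} (h : LeH a b) (p q : Mˣ) :
    LeH (p * a * q) (p * b * q) := by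
  obtain ⟨⟨s, hs⟩, t, ht⟩ := h
  refine ⟨⟨↑q⁻¹ * s * q, ?_⟩, p * t * ↑p⁻¹, ?_⟩
  · simp [hs, mul_assoc]
  · simp [ht, mul_assoc]

theorem RelH.units_mul_mul {M : Type*} [Monoid M] {a b : M} (h : RelH a b) (p q : Mˣ) :
    RelH (p * a * q) (p * b * q) :=
  (h.leH.units_mul_mul p q).relH (h.symm.leH.units_mul_mul p q)

theorem LeH.transpose {A B : Matrix ι ι S} (h : LeH A B) : LeH Aᵀ Bᵀ := by
  obtain ⟨⟨s, hs⟩, t, ht⟩ := h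
  exact ⟨⟨tᵀ, by rw [ht, transpose_mul]⟩, sᵀ, by rw [hs, transpose_mul]⟩

theorem RelH.transpose {A B : Matrix ι ι S} (h : RelH A B) : RelH Aᵀ Bᵀ :=
  h.leH.transpose.relH h.symm.leH.transpose

theorem preservesRel_relH_of_leH {M : Type*} [Monoid M] {f : M → M}
    (h : PreservesRel LeH f) : PreservesRel RelH f :=
  fun a b hab => (h a b hab.leH).relH (h b a hab.symm.leH)

end CommSemiring

end Green

/-! ### Combinatorics of rows and columns -/

open Green

/-- A rectangular array of pairs in which any two collinear cells agree in a coordinate, and whose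
rows are mapped sufficiently disjointly, is a product or a transposed product. -/
theorem row_column_dichotomy {ι α β : Type*} (X : ι → ι → α) (Y : ι → ι → β)
    (hrow : ∀ i j k, X i j = X i k ∨ Y i j = Y i k)
    (hcol : ∀ i k j, X i j = X k j ∨ Y i j = Y k j)
    (hXX : ∀ i k j₀, i ≠ k → (∀ j, X i j = X i j₀) → (∀ j, X k j = X i j₀) → False)
    (hYY : ∀ i k j₀, i ≠ k → (∀ j, Y i j = Y i j₀) → (∀ j, Y k j = Y i j₀) → False)
    (hXY : ∀ i k j₀, i ≠ k → (∀ j, X i j = X i j₀) → (∀ j, Y k j = Y k j₀) → False) :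
    ((∀ i j k, X i j = X i k) ∧ ∀ i k j, Y i j = Y k j) ∨
      ((∀ i j k, Y i j = Y i k) ∧ ∀ i k j, X i j = X k j) := by
  -- Pairwise agreement within one row already makes one coordinate constant on it.
  have key : ∀ i, (∀ j k, X i j = X i k) ∨ (∀ j k, Y i j = Y i k) := by
    intro i
    by_contra! h
    obtain ⟨⟨j, k, hX⟩, l, m, hY⟩ := h
    have h1 := hrow i j k
    have h2 := hrow i l m
    have h3 := hrow i j l
    have h4 := hrow i j m
    have h5 := hrow i k l
    have h6 := hrow i k m
    grind
  by_cases hX : ∀ i j k, X i j = X i k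
  · refine Or.inl ⟨hX, fun i k j => ?_⟩
    by_cases hik : i = k
    · rw [hik]
    refine (hcol i k j).resolve_left fun h => hXX i k j hik (fun l => hX i l j) fun l => ?_
    rw [h, hX k l j]
  by_cases hY : ∀ i j k, Y i j = Y i k
  · refine Or.inr ⟨hY, fun i k j => ?_⟩
    by_cases hik : i = k
    · rw [hik]
    refine (hcol i k j).resolve_right fun h => hYY i k j hik (fun l => hY i l j) fun l => ?_
    rw [h, hY k l j]
  exfalso
  push Not at hX hY
  obtain ⟨i, j, j', hi⟩ := hX
  obtain ⟨k, l, l', hk⟩ := hY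
  have hi' := (key i).resolve_left fun h => hi (h _ _)
  have hk' := (key k).resolve_right fun h => hk (h _ _)
  refine hXY k i l ?_ (fun j => hk' j l) (fun j => hi' j l)
  rintro rfl
  exact hi (hk' _ _)

/-! ### From separated matrix units to invertible factors -/

section Semifield

variable {ι S : Type*} [Semifield S]

/-- Transposing the values of a linear automorphism. -/
def transposeAfter (e : Matrix ι ι S ≃ₗ[S] Matrix ι ι S) : Matrix ι ι S ≃ₗ[S] Matrix ι ι S :=
  e.trans (transposeLinearEquiv ι ι S S)

/-- Transposing the arguments of a linear automorphism. -/
def transposeBefore (e : Matrix ι ι S ≃ₗ[S] Matrix ι ι S) : Matrix ι ι S ≃ₗ[S] Matrix ι ι S :=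
  (transposeLinearEquiv ι ι S S).trans e

@[simp] theorem transposeAfter_apply (e : Matrix ι ι S ≃ₗ[S] Matrix ι ι S) (A : Matrix ι ι S) :
    transposeAfter e A = (e A)ᵀ := rfl

@[simp] theorem transposeAfter_symm_apply (e : Matrix ι ι S ≃ₗ[S] Matrix ι ι S)
    (A : Matrix ι ι S) : (transposeAfter e).symm A = e.symm Aᵀ := rfl

@[simp] theorem transposeBefore_symm_apply (e : Matrix ι ι S ≃ₗ[S] Matrix ι ι S)
    (A : Matrix ι ι S) : (transposeBefore e).symm A = (e.symm A)ᵀ := rfl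

variable [Fintype ι] [DecidableEq ι]

theorem preservesRel_transposeAfter {e : Matrix ι ι S ≃ₗ[S] Matrix ι ι S}
    (h : PreservesRel RelH e) : PreservesRel RelH (transposeAfter e) :=
  fun A B hAB => (h A B hAB).transpose

theorem preservesRel_transposeBefore {e : Matrix ι ι S ≃ₗ[S] Matrix ι ι S}
    (h : PreservesRel RelH e) : PreservesRel RelH (transposeBefore e) :=
  fun _ _ hAB => h _ _ hAB.transpose

/-- The second block is the first with its columns swapped and rescaled, and equally with its rows
swapped and rescaled. No subtraction is needed, and the first block may be singular. -/
theorem relH_block {i k j l : ι} (hik : i ≠ k) (hjl : j ≠ l) {a b d e : S}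
    (ha : a ≠ 0) (hb : b ≠ 0) (hd : d ≠ 0) (he : e ≠ 0) :
    RelH (single i j a + single i l b + single k j d + single k l e)
      (single i j (b * d) + single i l (b * e) + single k j (d * e)
        + single k l (b * d * e / a)) := by
  refine ⟨⟨⟨single l j (a / (b * e)) + single j l (1 / d), ?_⟩,
    single l j d + single j l (b * e / a), ?_⟩,
    ⟨single i k (a / (d * e)) + single k i (1 / b), ?_⟩,
    single i k b + single k i (d * e / a), ?_⟩ <;>
  · simp only [add_mul, mul_add, single_mul_single_same, ne_eq, hik, hik.symm, hjl, hjl.symm,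
      not_false_eq_true, single_mul_single_of_ne, add_zero, zero_add]
    ext r s
    simp only [Matrix.add_apply, single_apply]
    by_cases h1 : i = r <;> by_cases h2 : j = s <;> by_cases h3 : k = r <;> by_cases h4 : l = s <;>
      simp_all <;> field_simp

theorem exists_units_of_symm_single {e : Matrix ι ι S ≃ₗ[S] Matrix ι ι S}
    (he : PreservesRel RelH e) {c : ι → ι → S} {x y : ι → ι → S}
    (h : ∀ i j, e.symm (single i j 1) = c i j • vecMulVec (x i) (y j)) :
    ∃ P Q : (Matrix ι ι S)ˣ, ∀ A, e A = P * A * Q := by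
  have hc : ∀ i j, c i j ≠ 0 := by
    intro i j h0
    have h1 := h i j
    rw [h0, zero_smul, LinearEquiv.map_eq_zero_iff] at h1
    have := congrFun (congrFun h1 i) j
    simp at this
  set X : Matrix ι ι S := (of x)ᵀ with hX
  set Y : Matrix ι ι S := of y with hY
  have hsingle : ∀ i j (t : S), X * single i j t * Y = t • vecMulVec (x i) (y j) := by
    intro i j t
    have : single i j t = t • vecMulVec (Pi.single i 1) (Pi.single j 1) := by
      rw [← single_eq_single_vecMulVec_single, smul_single, smul_eq_mul, mul_one]
    rw [this, mul_smul_comm, smul_mul_assoc, mul_vecMulVec, vecMulVec_mul]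
    congr 2 <;> ext r <;> simp [hX, hY]
  have hform : ∀ A, e.symm A = X * of (fun i j => A i j * c i j) * Y := by
    intro A
    conv_lhs => rw [matrix_eq_sum_single A]
    conv_rhs => rw [matrix_eq_sum_single (of _)]
    simp only [map_sum, Matrix.mul_sum, Matrix.sum_mul]
    refine Finset.sum_congr rfl fun i _ => Finset.sum_congr rfl fun j _ => ?_
    rw [hsingle, of_apply, mul_smul, ← h, ← map_smul, smul_single, smul_eq_mul, mul_one]
  have h1 := hform (e 1)
  rw [e.symm_apply_apply] at h1
  -- The factorization of `e.symm (e 1) = 1` gives one-sided inverses, which suffice for square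
  -- matrices.
  have hXu : IsUnit X := by
    rw [mul_assoc] at h1
    exact ⟨⟨X, _, h1.symm, mul_eq_one_comm.1 h1.symm⟩, rfl⟩
  have hYu : IsUnit Y := ⟨⟨Y, _, mul_eq_one_comm.1 h1.symm, h1.symm⟩, rfl⟩
  obtain ⟨P, hP⟩ := hXu
  obtain ⟨Q, hQ⟩ := hYu
  have heform : ∀ i j t, e (X * single i j t * Y) = single i j (t / c i j) := by
    intro i j t
    rw [hsingle, ← e.eq_symm_apply, ← mul_one (t / c i j), ← smul_eq_mul, ← smul_single, map_smul,
      h, smul_smul, div_mul_cancel₀ _ (hc i j)]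
  -- With `c` as the block, `e` sends the first matrix of `relH_block` to an all-ones block. The
  -- image of the second is a right multiple of it, so its two rows agree; this is the vanishing
  -- minor.
  have hmin : ∀ i k j l, c i j * c k l = c i l * c k j := by
    intro i k j l
    by_cases hik : i = k
    · subst hik; ring
    by_cases hjl : j = l
    · subst hjl; ring
    have hB := he _ _ ((relH_block hik hjl (hc i j) (hc i l) (hc k j) (hc k l)).units_mul_mul P Q)
    simp only [hP, hQ, mul_add, add_mul, map_add, heform, div_self (hc _ _)] at hB
    obtain ⟨s, hs⟩ := hB.1.2
    have e1 := congrFun (congrFun hs i) j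
    have e2 := congrFun (congrFun hs k) j
    simp [add_mul, hik, Ne.symm hik, Ne.symm hjl] at e1 e2
    have e3 := e1.trans e2.symm
    have := hc i j
    have := hc k j
    field_simp at e3
    exact e3.symm
  obtain hι | ⟨⟨o⟩⟩ := isEmpty_or_nonempty ι
  · exact ⟨1, 1, fun A => Subsingleton.elim _ _⟩
  have hD : ∀ d : ι → S, (∀ i, d i ≠ 0) → ∃ D : (Matrix ι ι S)ˣ, (D : Matrix ι ι S) = diagonal d :=
    fun d hd => ⟨⟨diagonal d, diagonal fun i => (d i)⁻¹, by simp [hd], by simp [hd]⟩, rfl⟩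
  obtain ⟨D, hD₁⟩ := hD (fun i => c i o) fun i => hc i o
  obtain ⟨E, hE₁⟩ := hD (fun j => c o j / c o o) fun j => div_ne_zero (hc _ _) (hc _ _)
  have hfac : ∀ A, e.symm A =
      ((P * D : (Matrix ι ι S)ˣ) : Matrix ι ι S) * A * (E * Q : (Matrix ι ι S)ˣ) := by
    intro A
    rw [hform, Units.val_mul, Units.val_mul, hP, hQ, hD₁, hE₁]
    have : of (fun i j => A i j * c i j)
        = diagonal (fun i => c i o) * A * diagonal fun j => c o j / c o o := by
      ext i j
      have h2 := hmin i o j o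
      have h3 := hc o o
      simp only [of_apply, mul_diagonal, diagonal_mul]
      field_simp
      rw [mul_assoc, h2, mul_assoc]
    rw [this]
    simp only [mul_assoc]
  refine ⟨(P * D)⁻¹, (E * Q)⁻¹, fun A => ?_⟩
  have := hfac (e A)
  rw [e.symm_apply_apply] at this
  conv_rhs => rw [this]
  simp only [← mul_assoc, Units.inv_mul, one_mul]
  rw [mul_assoc, Units.mul_inv, mul_one]

theorem exists_units_of_separated {e : Matrix ι ι S ≃ₗ[S] Matrix ι ι S}
    (he : PreservesRel RelH e)
    (h : (∃ (c : ι → ι → S) (a b : ι → ι → S),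
        ∀ i j, e.symm (single i j 1) = c i j • vecMulVec (a i) (b j)) ∨
      ∃ (c : ι → ι → S) (a b : ι → ι → S),
        ∀ i j, e.symm (single i j 1) = c i j • vecMulVec (a j) (b i)) :
    ∃ P Q : (Matrix ι ι S)ˣ, (∀ A, e A = P * A * Q) ∨ ∀ A, e A = P * Aᵀ * Q := by
  rcases h with ⟨c, a, b, h⟩ | ⟨c, a, b, h⟩
  · obtain ⟨P, Q, hPQ⟩ := exists_units_of_symm_single he h
    exact ⟨P, Q, Or.inl hPQ⟩
  · obtain ⟨P, Q, hPQ⟩ := exists_units_of_symm_single (preservesRel_transposeAfter he)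
      (c := fun i j => c j i) (x := a) (y := b) fun i j => by
        rw [transposeAfter_symm_apply, transpose_single, h]
    have hu : ∀ U : (Matrix ι ι S)ˣ, ∃ V : (Matrix ι ι S)ˣ, (V : Matrix ι ι S) = (U : Matrix ι ι S)ᵀ :=
      fun U => ⟨⟨U.1ᵀ, U.2ᵀ, by rw [← transpose_mul, U.inv_val, transpose_one],
        by rw [← transpose_mul, U.val_inv, transpose_one]⟩, rfl⟩
    obtain ⟨P', hP'⟩ := hu P
    obtain ⟨Q', hQ'⟩ := hu Q
    refine ⟨Q', P', Or.inr fun A => ?_⟩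
    rw [hP', hQ', ← transpose_transpose (e A), ← transposeAfter_apply, hPQ, transpose_mul,
      transpose_mul, mul_assoc]

end Semifield

/-! ### Fields -/

theorem span_eq_or_span_eq_of_vecMulVec_add {ι K : Type*} [Field K]
    {x x' x'' y y' y'' : ι → K} (hx : x ≠ 0) (hx' : x' ≠ 0)
    (hy : y ≠ 0) (hy' : y' ≠ 0)
    (h : vecMulVec x y + vecMulVec x' y' = vecMulVec x'' y'') :
    Submodule.span K {x} = Submodule.span K {x'} ∨ Submodule.span K {y} = Submodule.span K {y'} := by
  have hspan : ∀ {z w : ι → K} {r : K}, r ≠ 0 → ∀ {t : K}, z ≠ 0 → r • z = t • w →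
      Submodule.span K {z} = Submodule.span K {w} := by
    intro z w r hr t hz hzw
    have ht : t ≠ 0 := by
      rintro rfl
      rw [zero_smul] at hzw
      exact (smul_ne_zero hr hz) hzw
    rw [← Submodule.span_singleton_smul_eq (IsUnit.mk0 r hr), hzw,
      Submodule.span_singleton_smul_eq (IsUnit.mk0 t ht)]
  have hent : ∀ i j, x i * y j + x' i * y' j = x'' i * y'' j := fun i j =>
    congrFun (congrFun h i) j
  by_cases hmin : ∀ a b, y a * y' b = y b * y' a
  · right
    obtain ⟨a, ha⟩ := Function.ne_iff.1 hy'
    refine hspan (r := y' a) ha (t := y a) hy ?_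
    ext b
    simp only [Pi.smul_apply, smul_eq_mul]
    linear_combination -hmin a b
  -- A nonzero minor of `y, y'` lets one solve for `x` and `x'`, both multiples of `x''`.
  · left
    push Not at hmin
    obtain ⟨a, b, hab⟩ := hmin
    rw [← sub_ne_zero] at hab
    refine (hspan hab (w := x'') (t := y'' a * y' b - y'' b * y' a) hx ?_).trans
      (hspan hab (w := x'') (t := y'' b * y a - y'' a * y b) hx' ?_).symm
    · ext i
      simp only [Pi.smul_apply, smul_eq_mul]
      linear_combination y' b * hent i a - y' a * hent i b
    · ext i
      simp only [Pi.smul_apply, smul_eq_mul]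
      linear_combination y a * hent i b - y b * hent i a

section Field

variable {ι K : Type*} [Fintype ι] [DecidableEq ι] [Field K]

/-- A linear automorphism preserving `H` pulls back matrices of rank at most one to such. -/
theorem exists_symm_vecMulVec {e : Matrix ι ι K ≃ₗ[K] Matrix ι ι K} (he : PreservesRel RelH e)
    (u v : ι → K) : ∃ x y, e.symm (vecMulVec u v) = vecMulVec x y := by
  by_cases hu : u = 0
  · exact ⟨0, 0, by simp [hu]⟩
  obtain ⟨a, ha⟩ := Function.ne_iff.1 hu
  obtain ⟨L, L', d, hd⟩ :=
    Pivot.exists_list_transvec_mul_diagonal_mul_list_transvec (e.symm (vecMulVec u v))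
  have hunit : ∀ L : List (TransvectionStruct ι K),
      IsUnit (L.map TransvectionStruct.toMatrix).prod := fun L => by
    rw [isUnit_iff_isUnit_det, TransvectionStruct.det_toMatrix_prod]
    exact isUnit_one
  obtain ⟨P, hP⟩ := hunit L
  obtain ⟨Q, hQ⟩ := hunit L'
  rw [← hP, ← hQ] at hd
  -- Two nonzero pivots would make `diagonal d` `H`-related to the non-proportional `diagonal d +
  -- E_ij`; but anything `H`-below `u vᵀ` is a multiple of it.
  have hsub : ∀ i j, d i ≠ 0 → d j ≠ 0 → i = j := by
    intro i j hi hj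
    by_contra hij
    have hleft : diagonal d * single i j (d i)⁻¹ = single i j 1 := by
      ext r s
      rw [diagonal_mul, single_apply, single_apply]
      grind
    have hright : single i j (d j)⁻¹ * diagonal d = single i j 1 := by
      ext r s
      rw [mul_diagonal, single_apply, single_apply]
      grind
    have hrel : RelH (diagonal d) (diagonal d + single i j 1) := by
      refine ⟨⟨⟨1 - single i j (1 / d i), ?_⟩, 1 + single i j (1 / d i), ?_⟩,
        ⟨1 - single i j (1 / d j), ?_⟩, 1 + single i j (1 / d j), ?_⟩ <;>
      simp [mul_add, add_mul, mul_sub, sub_mul, hleft, hright, Ne.symm hij]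
    have h1 := he _ _ (hrel.units_mul_mul P Q)
    rw [← hd, e.apply_symm_apply] at h1
    obtain ⟨⟨-, s, hs⟩, -, t, ht⟩ := h1
    rw [vecMulVec_mul] at hs
    have hst := hs.symm.trans ht
    rw [mul_vecMulVec] at hst
    have hv : v ᵥ* s = ((t *ᵥ u) a / u a) • v := by
      ext b
      have := congrFun (congrFun hst a) b
      simp only [vecMulVec_apply] at this
      rw [Pi.smul_apply, smul_eq_mul, div_mul_eq_mul_div, eq_div_iff ha, mul_comm, this]
    rw [hv, vecMulVec_smul, ← e.eq_symm_apply, map_smul, hd, ← smul_mul_assoc, ← mul_smul_comm,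
      Units.mul_left_inj, Units.mul_right_inj] at hs
    have := congrFun (congrFun hs i) j
    simp [hij] at this
  by_cases h0 : ∀ i, d i = 0
  · refine ⟨0, 0, ?_⟩
    have : d = 0 := funext h0
    simp [hd, this]
  push Not at h0
  obtain ⟨i, hi⟩ := h0
  have : diagonal d = vecMulVec (Pi.single i (d i)) (Pi.single i 1) := by
    ext r s
    simp only [vecMulVec_apply, Pi.single_apply, diagonal_apply]
    grind
  exact ⟨P.1 *ᵥ Pi.single i (d i), Pi.single i 1 ᵥ* Q.1, by
    rw [hd, this, mul_vecMulVec, vecMulVec_mul]⟩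

/-- Dimension count: the row space injects into a space of the same dimension, so it fills it. -/
theorem exists_map_vecMulVec_eq (f : Matrix ι ι K ≃ₗ[K] Matrix ι ι K) {i : ι} {a : ι → K}
    (ha : a ≠ 0) (h : ∀ j, ∃ w, f (single i j 1) = vecMulVec a w) (w : ι → K) :
    ∃ v, f (vecMulVec (Pi.single i 1) v) = vecMulVec a w := by
  let m (u : ι → K) : (ι → K) →ₗ[K] Matrix ι ι K :=
    { toFun := vecMulVec u
      map_add' := vecMulVec_add u
      map_smul' := fun r => vecMulVec_smul r u }
  have hm : ∀ u, u ≠ 0 → Function.Injective (m u) := by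
    intro u hu
    rw [injective_iff_map_eq_zero]
    intro v hv
    exact (vecMulVec_eq_zero.1 hv).resolve_left hu
  have hg : Function.Injective (f.toLinearMap ∘ₗ m (Pi.single i 1)) :=
    f.injective.comp (hm _ (by simp))
  have hle : LinearMap.range (f.toLinearMap ∘ₗ m (Pi.single i 1)) ≤ LinearMap.range (m a) := by
    rintro _ ⟨v, rfl⟩
    rw [pi_eq_sum_univ' v, map_sum]
    refine Submodule.sum_mem _ fun j _ => ?_
    rw [map_smul]
    refine Submodule.smul_mem _ _ ?_
    obtain ⟨w, hw⟩ := h j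
    refine ⟨w, ?_⟩
    change vecMulVec a w = f (vecMulVec _ _)
    rw [← hw, single_eq_single_vecMulVec_single]
  have heq := Submodule.eq_of_le_of_finrank_eq hle (by
    rw [LinearMap.finrank_range_of_inj hg, LinearMap.finrank_range_of_inj (hm a ha)])
  have : m a w ∈ LinearMap.range (f.toLinearMap ∘ₗ m (Pi.single i 1)) := heq ▸ ⟨w, rfl⟩
  obtain ⟨v, hv⟩ := this
  exact ⟨v, hv⟩

theorem separated_of_preservesRel_relH_of_field {e : Matrix ι ι K ≃ₗ[K] Matrix ι ι K}
    (he : PreservesRel RelH e) :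
    (∃ (c : ι → ι → K) (a b : ι → ι → K),
        ∀ i j, e.symm (single i j 1) = c i j • vecMulVec (a i) (b j)) ∨
      ∃ (c : ι → ι → K) (a b : ι → ι → K),
        ∀ i j, e.symm (single i j 1) = c i j • vecMulVec (a j) (b i) := by
  obtain hι | ⟨⟨o⟩⟩ := isEmpty_or_nonempty ι
  · exact Or.inl ⟨0, 0, 0, fun i => hι.elim i⟩
  have hrank := exists_symm_vecMulVec he
  have hsingle : ∀ i j : ι, single i j (1 : K) = vecMulVec (Pi.single i 1) (Pi.single j 1) :=
    single_eq_single_vecMulVec_single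
  have h1 : ∀ i j, ∃ x y, e.symm (single i j 1) = vecMulVec x y := fun i j => by
    rw [hsingle]
    exact hrank _ _
  choose x y hxy using h1
  have hne : ∀ i j, x i j ≠ 0 ∧ y i j ≠ 0 := by
    intro i j
    rw [← not_or, ← vecMulVec_eq_zero, ← hxy, LinearEquiv.map_eq_zero_iff]
    intro h
    simpa using congrFun (congrFun h i) j
  have hmem : ∀ {z w : ι → K}, Submodule.span K {z} = Submodule.span K {w} → ∃ r : K, r • w = z :=
    fun h => Submodule.mem_span_singleton.1 (h ▸ Submodule.mem_span_singleton_self _)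
  have hXfull : ∀ i j₀, (∀ j, Submodule.span K {x i j} = Submodule.span K {x i j₀}) →
      ∀ w, ∃ v, e.symm (vecMulVec (Pi.single i 1) v) = vecMulVec (x i j₀) w := by
    intro i j₀ h
    refine exists_map_vecMulVec_eq e.symm (hne i j₀).1 fun j => ?_
    obtain ⟨r, hr⟩ := hmem (h j)
    exact ⟨r • y i j, by rw [hxy, ← hr, smul_vecMulVec, vecMulVec_smul]⟩
  have hYfull : ∀ i j₀, (∀ j, Submodule.span K {y i j} = Submodule.span K {y i j₀}) →
      ∀ w, ∃ v, e.symm (vecMulVec (Pi.single i 1) v) = vecMulVec w (y i j₀) := by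
    intro i j₀ h w
    obtain ⟨v, hv⟩ := exists_map_vecMulVec_eq (transposeAfter e.symm) (i := i) (hne i j₀).2
      (fun j => by
        obtain ⟨r, hr⟩ := hmem (h j)
        exact ⟨r • x i j, by
          rw [transposeAfter_apply, hxy, ← hr, transpose_vecMulVec, smul_vecMulVec,
            vecMulVec_smul]⟩) w
    refine ⟨v, ?_⟩
    rw [transposeAfter_apply] at hv
    rw [← transpose_transpose (e.symm _), hv, transpose_vecMulVec]
  have hdisj : ∀ {i k : ι} {v v' : ι → K}, i ≠ k → ∀ {z w : ι → K}, z ≠ 0 → w ≠ 0 →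
      e.symm (vecMulVec (Pi.single i 1) v) = vecMulVec z w →
      e.symm (vecMulVec (Pi.single k 1) v') = vecMulVec z w → False := by
    intro i k v v' hik z w hz hw h h'
    have h2 := e.symm.injective (h.trans h'.symm)
    have hv : v = 0 := by
      ext s
      simpa [vecMulVec_apply, hik] using congrFun (congrFun h2 i) s
    rw [hv, vecMulVec_zero, map_zero, eq_comm, vecMulVec_eq_zero] at h
    exact h.elim hz hw
  have hdich := row_column_dichotomy (fun i j => Submodule.span K {x i j})
    (fun i j => Submodule.span K {y i j})
    (fun i j k => by
      obtain ⟨x'', y'', h⟩ := hrank (Pi.single i 1) (Pi.single j 1 + Pi.single k 1)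
      rw [vecMulVec_add, ← hsingle, ← hsingle, map_add, hxy, hxy] at h
      exact span_eq_or_span_eq_of_vecMulVec_add (hne _ _).1 (hne _ _).1 (hne _ _).2 (hne _ _).2 h)
    (fun i k j => by
      obtain ⟨x'', y'', h⟩ := hrank (Pi.single i 1 + Pi.single k 1) (Pi.single j 1)
      rw [add_vecMulVec, ← hsingle, ← hsingle, map_add, hxy, hxy] at h
      exact span_eq_or_span_eq_of_vecMulVec_add (hne _ _).1 (hne _ _).1 (hne _ _).2 (hne _ _).2 h)
    (fun i k j₀ hik hi hk => by
      obtain ⟨v, hv⟩ := hXfull i j₀ hi (y k j₀)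
      obtain ⟨r, hr⟩ := hmem (hk j₀)
      refine hdisj hik (z := x i j₀) (w := y k j₀) (v' := r⁻¹ • Pi.single j₀ 1) (hne _ _).1
        (hne _ _).2 hv ?_
      have hr0 : r ≠ 0 := by
        rintro rfl
        exact (hne k j₀).1 (by rw [← hr, zero_smul])
      rw [vecMulVec_smul, map_smul, ← hsingle, hxy, ← hr, smul_vecMulVec, inv_smul_smul₀ hr0])
    (fun i k j₀ hik hi hk => by
      obtain ⟨v, hv⟩ := hYfull i j₀ hi (x k j₀)
      obtain ⟨r, hr⟩ := hmem (hk j₀)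
      refine hdisj hik (z := x k j₀) (w := y i j₀) (v' := r⁻¹ • Pi.single j₀ 1) (hne _ _).1
        (hne _ _).2 hv ?_
      have hr0 : r ≠ 0 := by
        rintro rfl
        exact (hne k j₀).2 (by rw [← hr, zero_smul])
      rw [vecMulVec_smul, map_smul, ← hsingle, hxy, ← hr, vecMulVec_smul, inv_smul_smul₀ hr0])
    (fun i k j₀ hik hi hk => by
      obtain ⟨v, hv⟩ := hXfull i j₀ hi (y k j₀)
      obtain ⟨v', hv'⟩ := hYfull k j₀ hk (x i j₀)
      exact hdisj hik (hne _ _).1 (hne _ _).2 hv hv')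
  rcases hdich with ⟨hX, hY⟩ | ⟨hY, hX⟩
  · choose r hr using fun i j => hmem (hX i j o)
    choose s hs using fun i j => hmem (hY i o j)
    refine Or.inl ⟨fun i j => r i j * s i j, fun i => x i o, fun j => y o j, fun i j => ?_⟩
    rw [hxy, ← hr, ← hs, smul_vecMulVec, vecMulVec_smul, smul_smul]
  · choose r hr using fun i j => hmem (hX i o j)
    choose s hs using fun i j => hmem (hY i j o)
    refine Or.inr ⟨fun i j => r i j * s i j, fun j => x o j, fun i => y i o, fun i j => ?_⟩
    rw [hxy, ← hr, ← hs, smul_vecMulVec, vecMulVec_smul, smul_smul]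

end Field

/-! ### Antinegative semifields -/

section Antinegative

variable {ι S : Type*} [DecidableEq ι] [Semifield S]

theorem exists_symm_single_eq_single (hS : ∀ a b : S, a + b = 0 → a = 0)
    (e : Matrix ι ι S ≃ₗ[S] Matrix ι ι S) (i j : ι) :
    ∃ k l c, c ≠ 0 ∧ e.symm (single i j 1) = single k l c := by
  set M := e.symm (single i j 1) with hM
  have hM0 : M ≠ 0 := by
    rw [hM, ne_eq, LinearEquiv.map_eq_zero_iff]
    intro h
    simpa using congrFun (congrFun h i) j
  -- As nothing cancels, each unit in the support of `M` maps to a multiple of `E_ij`; two such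
  -- units would have proportional images.
  have key : ∀ k l, M k l ≠ 0 → ∃ t, t ≠ 0 ∧ e (single k l 1) = single i j t := by
    intro k l hkl
    have hsplit : M = M k l • single k l 1 + of fun r s => if k = r ∧ l = s then 0 else M r s := by
      ext r s
      simp only [Matrix.add_apply, Matrix.smul_apply, single_apply, of_apply]
      by_cases h : k = r ∧ l = s
      · simp [h.1, h.2]
      · simp [h]
    have he := congrArg e hsplit
    rw [hM, e.apply_symm_apply, ← hM, map_add, map_smul] at he
    have hform : e (single k l 1) = single i j (e (single k l 1) i j) := by
      ext r s
      by_cases h : i = r ∧ j = s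
      · simp [h.1, h.2]
      · have h1 := congrFun (congrFun he r) s
        rw [single_apply_of_ne _ _ _ _ _ h] at h1 ⊢
        exact (mul_eq_zero.1 (hS _ _ h1.symm)).resolve_left hkl
    refine ⟨_, fun h0 => ?_, hform⟩
    rw [h0, single_zero, LinearEquiv.map_eq_zero_iff] at hform
    simpa using congrFun (congrFun hform k) l
  obtain ⟨k, l, hkl⟩ : ∃ k l, M k l ≠ 0 := by
    by_contra! h
    exact hM0 (Matrix.ext h)
  refine ⟨k, l, M k l, hkl, ?_⟩
  ext r s
  by_cases h : k = r ∧ l = s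
  · simp [h.1, h.2]
  rw [single_apply_of_ne _ _ _ _ _ h]
  by_contra hrs
  obtain ⟨t, ht, ht'⟩ := key k l hkl
  obtain ⟨t₁, -, ht₁'⟩ := key r s hrs
  have h2 : e (t₁ • single k l 1) = e (t • single r s 1) := by
    rw [map_smul, map_smul, ht', ht₁', smul_single, smul_single, smul_eq_mul, smul_eq_mul, mul_comm]
  have h3 := congrFun (congrFun (e.injective h2) r) s
  rw [Matrix.smul_apply, Matrix.smul_apply, single_apply_of_ne _ _ _ _ _ h, single_apply_same,
    smul_zero, smul_eq_mul, mul_one] at h3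
  exact ht h3.symm

variable [Fintype ι]

theorem relH_antidiagonal {a a' b b' : ι} (ha : a ≠ a') (hb : b ≠ b') {c c' : S} (hc : c ≠ 0)
    (hc' : c' ≠ 0) :
    RelH (single a b' c + single a' b c') (single a b c + single a' b' c') := by
  refine ⟨⟨⟨single b b' 1 + single b' b 1, ?_⟩, single b b' 1 + single b' b 1, ?_⟩,
    ⟨single a a' (c / c') + single a' a (c' / c), ?_⟩,
    single a a' (c / c') + single a' a (c' / c), ?_⟩ <;>
  simp [mul_add, add_mul, ha, ha.symm, hb, hb.symm, hc, hc', add_comm]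

theorem collinear_of_preservesRel_relH (hS : ∀ a b : S, a + b = 0 → a = 0)
    {e : Matrix ι ι S ≃ₗ[S] Matrix ι ι S} (he : PreservesRel RelH e)
    {i j k a b a' b' : ι} {c c' : S} (hc : c ≠ 0) (hc' : c' ≠ 0)
    (h : e.symm (single i j 1) = single a b c) (h' : e.symm (single i k 1) = single a' b' c') :
    a = a' ∨ b = b' := by
  by_contra! hne
  obtain ⟨ha, hb⟩ := hne
  have hjk : j ≠ k := by
    rintro rfl
    have := congrFun (congrFun (h.symm.trans h') a) b
    rw [single_apply_same, single_apply_of_row_ne ha.symm] at this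
    exact hc this
  obtain ⟨⟨⟨s, hs⟩, -⟩, ⟨t, ht⟩, -⟩ := he _ _ (relH_antidiagonal ha hb hc hc')
  rw [map_add, map_add, ← h, ← h', e.apply_symm_apply, e.apply_symm_apply] at hs ht
  set D := e (single a b' c) with hD
  -- `D` is a summand of a matrix living in row `i` and columns `j, k`, so it lives there too.
  have hform : D = D i j • single i j 1 + D i k • single i k 1 := by
    ext r q
    by_cases hr : i = r
    · subst hr
      by_cases hq : j = q
      · subst hq
        simp [hjk.symm]
      by_cases hq' : k = q
      · subst hq'
        simp [hjk]
      have h1 := congrFun (congrFun ht i) q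
      simp only [mul_add, Matrix.add_apply, mul_single_apply_of_ne _ _ _ _ _ (Ne.symm hq),
        mul_single_apply_of_ne _ _ _ _ _ (Ne.symm hq'), add_zero] at h1
      simp [hS _ _ h1, hq, hq']
    · have h1 := congrFun (congrFun hs r) q
      simp only [add_mul, Matrix.add_apply, single_mul_apply_of_ne _ _ _ _ _ (Ne.symm hr),
        add_zero] at h1
      simp [hS _ _ h1, hr]
  have h2 := congrArg e.symm hform
  rw [hD, e.symm_apply_apply, ← hD, map_add, map_smul, map_smul, h, h'] at h2
  have h3 := congrFun (congrFun h2 a) b'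
  simp [hb, ha.symm] at h3
  exact hc h3

theorem separated_of_preservesRel_relH_of_antinegative (hS : ∀ a b : S, a + b = 0 → a = 0)
    {e : Matrix ι ι S ≃ₗ[S] Matrix ι ι S} (he : PreservesRel RelH e) :
    (∃ (c : ι → ι → S) (a b : ι → ι → S),
        ∀ i j, e.symm (single i j 1) = c i j • vecMulVec (a i) (b j)) ∨
      ∃ (c : ι → ι → S) (a b : ι → ι → S),
        ∀ i j, e.symm (single i j 1) = c i j • vecMulVec (a j) (b i) := by
  obtain hι | ⟨⟨o⟩⟩ := isEmpty_or_nonempty ι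
  · exact Or.inl ⟨0, 0, 0, fun i => hι.elim i⟩
  choose X Y c hc hXY using exists_symm_single_eq_single hS e
  have hinj : ∀ i j k l, X i j = X k l → Y i j = Y k l → i = k ∧ j = l := by
    intro i j k l h1 h2
    have h3 : e.symm (c k l • single i j 1) = e.symm (c i j • single k l 1) := by
      rw [map_smul, map_smul, hXY, hXY, h1, h2, smul_single, smul_single, smul_eq_mul, smul_eq_mul,
        mul_comm]
    have h4 := congrFun (congrFun (e.symm.injective h3) i) j
    by_contra hne
    rw [Matrix.smul_apply, Matrix.smul_apply, single_apply_same,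
      single_apply_of_ne _ _ _ _ _ (fun h => hne ⟨h.1.symm, h.2.symm⟩), smul_zero, smul_eq_mul,
      mul_one] at h4
    exact hc _ _ h4
  have hXfull : ∀ i j₀, (∀ j, X i j = X i j₀) → ∀ q, ∃ j, Y i j = q := fun i j₀ h =>
    Finite.injective_iff_surjective.1 fun j k hjk =>
      (hinj i j i k ((h j).trans (h k).symm) hjk).2
  have hYfull : ∀ i j₀, (∀ j, Y i j = Y i j₀) → ∀ q, ∃ j, X i j = q := fun i j₀ h =>
    Finite.injective_iff_surjective.1 fun j k hjk =>
      (hinj i j i k hjk ((h j).trans (h k).symm)).2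
  have hdich := row_column_dichotomy X Y
    (fun i j k => collinear_of_preservesRel_relH hS he (hc i j) (hc i k) (hXY i j) (hXY i k))
    (fun i k j => (collinear_of_preservesRel_relH hS
      (preservesRel_transposeAfter (preservesRel_transposeBefore he)) (hc i j) (hc k j)
      (i := j) (j := i) (k := k) (a := Y i j) (a' := Y k j) (b := X i j) (b' := X k j)
      (by simp [hXY]) (by simp [hXY])).symm)
    (fun i k j₀ hik hi hk => by
      obtain ⟨j, hj⟩ := hXfull i j₀ hi (Y k j₀)
      exact hik (hinj i j k j₀ ((hi j).trans (hk j₀).symm) hj).1)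
    (fun i k j₀ hik hi hk => by
      obtain ⟨j, hj⟩ := hYfull i j₀ hi (X k j₀)
      exact hik (hinj i j k j₀ hj ((hi j).trans (hk j₀).symm)).1)
    (fun i k j₀ hik hi hk => by
      obtain ⟨j, hj⟩ := hXfull i j₀ hi (Y k j₀)
      obtain ⟨l, hl⟩ := hYfull k j₀ hk (X i j₀)
      exact hik (hinj i j k l ((hi j).trans hl.symm) (hj.trans (hk l).symm)).1)
  have hsingle : ∀ (i j : ι) (t : S),
      single i j t = t • vecMulVec (Pi.single i 1) (Pi.single j 1) := fun i j t => by
    rw [← single_eq_single_vecMulVec_single, smul_single, smul_eq_mul, mul_one]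
  rcases hdich with ⟨hX, hY⟩ | ⟨hY, hX⟩
  · exact Or.inl ⟨c, fun i => Pi.single (X i o) 1, fun j => Pi.single (Y o j) 1, fun i j => by
      rw [hXY, hsingle, hX i j o, hY i o j]⟩
  · exact Or.inr ⟨c, fun j => Pi.single (X o j) 1, fun i => Pi.single (Y i o) 1, fun i j => by
      rw [hXY, hsingle, hX i o j, hY i j o]⟩

end Antinegative

/-! ### Field or antinegative: the conclusion -/

/-- A semifield in which `1` has a negative is a field. -/
abbrev Field.ofSemifield {S : Type*} [Semifield S] (m : S) (hm : 1 + m = 0) : Field S :=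
  { ‹Semifield S› with
    neg := fun a => m * a
    zsmul := letI : Neg S := ⟨fun a => m * a⟩; zsmulRec
    neg_add_cancel := fun a => by
      change m * a + a = 0
      rw [← add_one_mul, add_comm, hm, zero_mul]
    qsmul := _
    qsmul_def := fun _ _ => rfl }

theorem exists_units_of_preservesRel_relH {ι S : Type*} [Fintype ι] [DecidableEq ι] [Semifield S]
    {e : Matrix ι ι S ≃ₗ[S] Matrix ι ι S} (he : PreservesRel RelH e) :
    ∃ P Q : (Matrix ι ι S)ˣ, (∀ A, e A = P * A * Q) ∨ ∀ A, e A = P * Aᵀ * Q := by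
  refine exists_units_of_separated he ?_
  by_cases h : ∃ m : S, 1 + m = 0
  · obtain ⟨m, hm⟩ := h
    let _ := Field.ofSemifield m hm
    exact separated_of_preservesRel_relH_of_field he
  · refine separated_of_preservesRel_relH_of_antinegative (fun a b hab => ?_) he
    by_contra ha
    exact h ⟨b / a, by rw [← div_self ha, ← add_div, hab, zero_div]⟩

theorem mainTheorem4 {S : Type*} [Semifield S] (n : ℕ)
    (T : Matrix (Fin n) (Fin n) S →ₗ[S] Matrix (Fin n) (Fin n) S)
    (hT : Function.Bijective T) :
    List.TFAE
      [PreservesRel Green.RelH T,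
       PreservesRel Green.LeH T,
       ∃ P Q : (Matrix (Fin n) (Fin n) S)ˣ,
         (∀ A : Matrix (Fin n) (Fin n) S,
            T A = (P : Matrix (Fin n) (Fin n) S) * A * (Q : Matrix (Fin n) (Fin n) S)) ∨
         (∀ A : Matrix (Fin n) (Fin n) S,
            T A = (P : Matrix (Fin n) (Fin n) S) * A.transpose *
              (Q : Matrix (Fin n) (Fin n) S))] := by

  tfae_have 2 → 1 := preservesRel_relH_of_leH
  tfae_have 1 → 3 := fun h =>
    exists_units_of_preservesRel_relH (e := LinearEquiv.ofBijective T hT) h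
  tfae_have 3 → 2 := by
    rintro ⟨P, Q, h | h⟩ A B hAB
    · rw [h, h]
      exact hAB.units_mul_mul P Q
    · rw [h, h]
      exact hAB.transpose.units_mul_mul P Q
  tfae_finish
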